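/- For $x,p\in\mathbb{C}$ with $|p|<1$ write $(x;p)_n=\prod_{k=0}^{n-1}(1-xp^k)$ for $n=0,1,2,\dots$ and for $n=\infty$, and $(x_1,\dots,x_m;p)_n=(x_1;p)_n\cdots(x_m;p)_n$. Theorem T9. Let $q,a,b\in\mathbb{C}$ with $|q|<1$ and $\max\{|aq^2|,|bq^2|,|ab|\}<1$. Then $$ \begin{aligned} &\frac{(q^2,ab;q^2)_\infty}{(aq^2,bq^2;q^2)_\infty}\sum_{n=0}^\infty\frac{(q^2/a,q^2/b;q^2)_n}{(-q,q^2;q^2)_n\,(q;q^2)_{n+1}}\,a^nb^n\\ &\quad=\sum_{n=0}^\infty(-1)^n(1+q^{4n+1})\frac{(q^2/a,q^2/b;q^2)_{2n}}{(aq^2,bq^2;q^2)_{2n}}(ab)^{2n}q^{6n^2+2n}\\ &\qquad-\sum_{n=0}^\infty(-1)^n(1+q^{4n+3})\frac{(q^2/a,q^2/b;q^2)_{2n+1}}{(aq^2,bq^2;q^2)_{2n+1}}(ab)^{2n+1}q^{6n^2+6n+1}, \end{aligned} $$ where all three series converge absolutely. If $a=0$ or $b=0$, the identity holds with the expressions $(q^2/a;q^2)_m\,a^m$,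 respectively $(q^2/b;q^2)_m\,b^m$, replaced by their limits $(-1)^mq^{m(m+1)}$ as $a\to0$, respectively $b\to0$. -/

import Mathlib

open Filter Topology

/-- The finite `q`-shifted factorial `(x; p)_n = ∏_{k=0}^{n-1} (1 - x p^k)`. -/
def qShift (x p : ℂ) (n : ℕ) : ℂ := ∏ k ∈ Finset.range n, (1 - x * p ^ k)

/-- The infinite `q`-shifted factorial `(x; p)_∞ = ∏_{k=0}^∞ (1 - x p^k)`. -/
noncomputable def qShiftInf (x p : ℂ) : ℂ := ∏' k : ℕ, (1 - x * p ^ k)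

/-- The expression `(p/a; p)_n a^n`, extended to `a = 0` by its limit. It is written as the product
`∏_{k=0}^{n-1} (a - p^(k+1))`. The three lemmas below identify it with `(p/a; p)_n a^n` for
`a ≠ 0`, with the limit of that expression for `a = 0`, and give the limit explicitly. -/
def qShiftScaled (a p : ℂ) (n : ℕ) : ℂ := ∏ k ∈ Finset.range n, (a - p ^ (k + 1))

/-- The infinite product converges when `|p| < 1`. -/
theorem qShiftInf_multipliable (x : ℂ) {p : ℂ} (hp : ‖p‖ < 1) :
    Multipliable (fun k : ℕ => 1 - x * p ^ k) := by
  have h : Summable (fun k : ℕ => ‖-(x * p ^ k)‖) := by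
    simp only [norm_neg, norm_mul, norm_pow]
    exact (summable_geometric_of_lt_one (norm_nonneg p) hp).mul_left _
  simpa [sub_eq_add_neg] using multipliable_one_add_of_summable h

theorem qShiftScaled_of_ne_zero {a : ℂ} (ha : a ≠ 0) (p : ℂ) (n : ℕ) :
    qShiftScaled a p n = qShift (p / a) p n * a ^ n := by
  unfold qShiftScaled qShift
  induction n with
  | zero => simp
  | succ n ih =>
    have h : a - p ^ (n + 1) = (1 - p / a * p ^ n) * a := by
      field_simp
      ring
    rw [Finset.prod_range_succ, Finset.prod_range_succ, ih, h]
    ring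

theorem qShiftScaled_tendsto (p : ℂ) (n : ℕ) :
    Tendsto (fun a : ℂ => qShift (p / a) p n * a ^ n) (𝓝[≠] 0) (𝓝 (qShiftScaled 0 p n)) := by
  have hc : Continuous (fun a : ℂ => qShiftScaled a p n) := by
    unfold qShiftScaled
    fun_prop
  refine ((hc.tendsto 0).mono_left nhdsWithin_le_nhds).congr' ?_
  filter_upwards [self_mem_nhdsWithin] with a ha
  exact qShiftScaled_of_ne_zero ha p n

theorem qShiftScaled_zero (p : ℂ) (n : ℕ) :
    qShiftScaled 0 p n = (-1) ^ n * p ^ (n * (n + 1) / 2) := by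
  have h : n * (n + 1) / 2 = ∑ k ∈ Finset.range n, (k + 1) := by
    have := Finset.sum_range_succ' (fun k : ℕ => k) n
    have h2 := Finset.sum_range_id (n + 1)
    simp only [Nat.add_sub_cancel] at h2
    rw [mul_comm, ← h2, this, add_zero]
  rw [h, ← Finset.prod_pow_eq_pow_sum]
  simp [qShiftScaled, Finset.prod_neg]

/-!
Bailey's lemma turns a pair `β n = ∑ r ≤ n, α r / ((p; p)_{n-r} (cp; p)_{n+r})` into an identity
between a series in `β` and a series in `α`: inserting the definition of `β` and summing over `n`
first, each inner sum is a `q`-Gauss series. The `q`-Gauss sum itself follows from a contiguous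
relation whose error term telescopes; iterating it lets two of the parameters tend to zero.

Here `p = c = q²`, and `α` is the two-sided sequence `(-1)^n (p^(3n²+n) + q p^(3n²+3n))` folded
onto the natural numbers. Writing `S_j(M, N) = ∑ (-1)^n p^(3n²+jn) / ((p; p)_{M-2n} (p; p)_{N+2n})`,
the `q`-Pascal rules relate sums with consecutive `M`, `N`. The reflection `n ↦ -n` gives
`S_{-j}(M, N) = S_j(N, M)` and `n ↦ -1 - n` gives `S_3(M, M + 2) = 0`, so the rules close up into a
recursion for `S_1(N, N)`, whose solution is `(-p; p)_N / (p; p)_{2N}`.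
-/

section QShift

variable {x p : ℂ}

theorem mul_pow_ne_one (hx : ‖x‖ < 1) (hp : ‖p‖ ≤ 1) (n : ℕ) : x * p ^ n ≠ 1 := by
  intro h
  have hlt : ‖x * p ^ n‖ < 1 := by
    rw [norm_mul, norm_pow]
    exact mul_lt_one_of_nonneg_of_lt_one_left (norm_nonneg x) hx (pow_le_one₀ (norm_nonneg p) hp)
  exact hlt.ne (by rw [h, norm_one])

theorem mul_pow_mul_pow_ne_one (hx : ∀ k : ℕ, x * p ^ k ≠ 1) (m k : ℕ) :
    x * p ^ m * p ^ k ≠ 1 := by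
  rw [mul_assoc, ← pow_add]
  exact hx (m + k)

theorem qShift_zero (x p : ℂ) : qShift x p 0 = 1 := by simp [qShift]

theorem qShift_succ (x p : ℂ) (n : ℕ) :
    qShift x p (n + 1) = qShift x p n * (1 - x * p ^ n) :=
  Finset.prod_range_succ _ n

theorem qShift_add (x p : ℂ) (m n : ℕ) :
    qShift x p (m + n) = qShift x p m * qShift (x * p ^ m) p n := by
  simp only [qShift, Finset.prod_range_add, pow_add, mul_assoc]

theorem qShift_succ' (x p : ℂ) (n : ℕ) :
    qShift x p (n + 1) = (1 - x) * qShift (x * p) p n := by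
  rw [add_comm, qShift_add]
  simp [qShift]

theorem qShift_mul_qShift_neg (x p : ℂ) (n : ℕ) :
    qShift x p n * qShift (-x) p n = qShift (x ^ 2) (p ^ 2) n := by
  simp only [qShift, ← Finset.prod_mul_distrib]
  exact Finset.prod_congr rfl fun k _ => by ring

theorem qShift_two_mul_add_one (x p : ℂ) (n : ℕ) :
    qShift x p (2 * n + 1) = qShift x (p ^ 2) (n + 1) * qShift (x * p) (p ^ 2) n := by
  induction n with
  | zero => simp [qShift]
  | succ n ih =>
    rw [mul_add_one, qShift_succ, qShift_succ, ih, qShift_succ x (p ^ 2) (n + 1),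
      qShift_succ (x * p)]
    ring

theorem qShift_ne_zero (hx : ∀ k : ℕ, x * p ^ k ≠ 1) (n : ℕ) : qShift x p n ≠ 0 :=
  Finset.prod_ne_zero_iff.mpr fun k _ => sub_ne_zero.mpr (hx k).symm

theorem tendsto_qShift (x : ℂ) (hp : ‖p‖ < 1) :
    Tendsto (qShift x p) atTop (𝓝 (qShiftInf x p)) :=
  (qShiftInf_multipliable x hp).tendsto_prod_tprod_nat

theorem qShiftInf_eq_qShift_mul (x : ℂ) (hp : ‖p‖ < 1) (n : ℕ) :
    qShiftInf x p = qShift x p n * qShiftInf (x * p ^ n) p := by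
  refine tendsto_nhds_unique ((tendsto_qShift x hp).comp (tendsto_add_atTop_nat n)) ?_
  refine ((tendsto_qShift (x * p ^ n) hp).const_mul (qShift x p n)).congr fun m => ?_
  rw [Function.comp_apply, add_comm, qShift_add]

theorem qShiftInf_ne_zero (hx : ∀ k : ℕ, x * p ^ k ≠ 1) (hp : ‖p‖ < 1) : qShiftInf x p ≠ 0 := by
  have hsum : Summable fun k : ℕ => ‖-(x * p ^ k)‖ := by
    simp only [norm_neg, norm_mul, norm_pow]
    exact (summable_geometric_of_lt_one (norm_nonneg p) hp).mul_left _
  simpa only [qShiftInf, sub_eq_add_neg] using tprod_one_add_ne_zero_of_summable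
    (fun k => by simpa only [sub_eq_add_neg] using sub_ne_zero.mpr (hx k).symm) hsum

theorem exists_norm_qShift_le (x : ℂ) (hp : ‖p‖ < 1) : ∃ K, ∀ n, ‖qShift x p n‖ ≤ K := by
  obtain ⟨K, hK⟩ := (tendsto_qShift x hp).norm.bddAbove_range
  exact ⟨K, fun n => hK ⟨n, rfl⟩⟩

theorem exists_norm_inv_qShift_le (hx : ∀ k : ℕ, x * p ^ k ≠ 1) (hp : ‖p‖ < 1) :
    ∃ K, ∀ n, ‖(qShift x p n)⁻¹‖ ≤ K := by
  obtain ⟨K, hK⟩ := ((tendsto_qShift x hp).inv₀ (qShiftInf_ne_zero hx hp)).norm.bddAbove_range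
  exact ⟨K, fun n => hK ⟨n, rfl⟩⟩

theorem exists_norm_inv_qShift_mul_pow_le (hx : ∀ k : ℕ, x * p ^ k ≠ 1) (hp : ‖p‖ < 1) :
    ∃ K, ∀ m n, ‖(qShift (x * p ^ m) p n)⁻¹‖ ≤ K := by
  obtain ⟨K, hK⟩ := exists_norm_qShift_le x hp
  obtain ⟨L, hL⟩ := exists_norm_inv_qShift_le hx hp
  refine ⟨K * L, fun m n => ?_⟩
  have hquot : (qShift (x * p ^ m) p n)⁻¹ = qShift x p m * (qShift x p (m + n))⁻¹ := by
    rw [qShift_add, mul_inv, mul_inv_cancel_left₀ (qShift_ne_zero hx m)]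
  rw [hquot, norm_mul]
  exact mul_le_mul (hK m) (hL _) (norm_nonneg _) ((norm_nonneg _).trans (hK m))

end QShift

section QShiftHom

/-- The homogeneous `q`-shifted factorial `∏_{k=0}^{n-1} (a - u p^k)`, which is `a^n (u/a; p)_n`
for `a ≠ 0`. It lets the numerator parameters `u/a` of a basic hypergeometric series become
infinite. -/
def qShiftHom (a u p : ℂ) (n : ℕ) : ℂ := ∏ k ∈ Finset.range n, (a - u * p ^ k)

theorem qShiftHom_zero (a u p : ℂ) : qShiftHom a u p 0 = 1 := by simp [qShiftHom]

theorem qShiftHom_succ (a u p : ℂ) (n : ℕ) :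
    qShiftHom a u p (n + 1) = qShiftHom a u p n * (a - u * p ^ n) :=
  Finset.prod_range_succ _ n

theorem qShiftHom_add (a u p : ℂ) (m n : ℕ) :
    qShiftHom a u p (m + n) = qShiftHom a u p m * qShiftHom a (u * p ^ m) p n := by
  simp only [qShiftHom, Finset.prod_range_add, pow_add, mul_assoc]

theorem qShiftHom_mul_mul (a u p c : ℂ) (n : ℕ) :
    qShiftHom (a * c) (u * c) p n = c ^ n * qShiftHom a u p n := by
  induction n with
  | zero => simp [qShiftHom]
  | succ n ih =>
    rw [qShiftHom_succ, qShiftHom_succ, ih]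
    ring

theorem qShiftHom_self (a p : ℂ) (n : ℕ) : qShiftHom a p p n = qShiftScaled a p n := by
  simp only [qShiftHom, qShiftScaled, pow_succ']

variable {p a b : ℂ}

theorem exists_summable_norm_qShiftHom_mul_le (u v : ℂ) (hp : ‖p‖ < 1) (hab : ‖a * b‖ < 1) :
    ∃ B : ℕ → ℝ, Summable B ∧ ∀ i j k n,
      ‖qShiftHom (a * p ^ i) (u * p ^ j) p n * qShiftHom b (v * p ^ k) p n‖ ≤ B n := by
  set c : ℕ → ℝ := fun n => (‖a‖ + ‖u‖ * ‖p‖ ^ n) * (‖b‖ + ‖v‖ * ‖p‖ ^ n) with hc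
  have hc_nonneg : ∀ n, 0 ≤ c n := fun n => by positivity
  have hc_lim : Tendsto c atTop (𝓝 ‖a * b‖) := by
    have hpow := tendsto_pow_atTop_nhds_zero_of_lt_one (norm_nonneg p) hp
    simpa using ((hpow.const_mul ‖u‖).const_add ‖a‖).mul ((hpow.const_mul ‖v‖).const_add ‖b‖)
  obtain ⟨ρ, hρ, hρ_lt⟩ := exists_between hab
  refine ⟨fun n => ∏ k ∈ Finset.range n, c k, ?_, fun i j k n => ?_⟩
  · refine summable_of_ratio_norm_eventually_le hρ_lt ?_
    filter_upwards [hc_lim.eventually_le_const hρ] with n hn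
    rw [Finset.prod_range_succ, norm_mul, mul_comm, Real.norm_of_nonneg (hc_nonneg n)]
    gcongr
  · have hfactor : ∀ x y : ℂ, ∀ s t m : ℕ, ‖x * p ^ s - y * p ^ t * p ^ m‖ ≤
        ‖x‖ + ‖y‖ * ‖p‖ ^ m := fun x y s t m => by
      refine (norm_sub_le _ _).trans ?_
      simp only [norm_mul, norm_pow]
      gcongr <;> exact mul_le_of_le_one_right (norm_nonneg _) (pow_le_one₀ (norm_nonneg p) hp.le)
    simp only [qShiftHom, ← Finset.prod_mul_distrib, norm_prod, norm_mul, hc]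
    gcongr with m
    · exact hfactor a u i j m
    · simpa using hfactor b v 0 k m

theorem summable_qShiftHom_mul (u v : ℂ) (hp : ‖p‖ < 1) (hab : ‖a * b‖ < 1) :
    Summable fun n => qShiftHom a u p n * qShiftHom b v p n := by
  obtain ⟨B, hB, hle⟩ := exists_summable_norm_qShiftHom_mul_le u v hp hab
  exact .of_norm_bounded hB fun n => by simpa using hle 0 0 0 n

end QShiftHom

section QGauss

/-- The terms of the `q`-Gauss series `₂φ₁(u/a, v/b; uv; p, ab)`, in homogeneous form so that
`a = 0` and `b = 0` are allowed. -/
noncomputable def qGaussTerm (p a b u v : ℂ) (n : ℕ) : ℂ :=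
  qShiftHom a u p n * qShiftHom b v p n / (qShift p p n * qShift (u * v) p n)

variable {p a b u v : ℂ}

theorem exists_summable_norm_qGaussTerm_le (hp : ‖p‖ < 1) (hab : ‖a * b‖ < 1)
    (huv : ∀ k : ℕ, u * v * p ^ k ≠ 1) :
    ∃ B : ℕ → ℝ, Summable B ∧ ∀ i j k n,
      ‖qGaussTerm p (a * p ^ i) b (u * p ^ j) (v * p ^ k) n‖ ≤ B n := by
  obtain ⟨B, hB, hnum⟩ := exists_summable_norm_qShiftHom_mul_le u v hp hab
  obtain ⟨K, hK⟩ := exists_norm_inv_qShift_le (mul_pow_ne_one hp hp.le) hp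
  obtain ⟨L, hL⟩ := exists_norm_inv_qShift_mul_pow_le huv hp
  refine ⟨fun n => B n * (K * L), hB.mul_right _, fun i j k n => ?_⟩
  rw [qGaussTerm, div_eq_mul_inv, mul_inv, norm_mul, norm_mul (qShift p p n)⁻¹,
    mul_mul_mul_comm u, ← pow_add]
  exact mul_le_mul (hnum i j k n)
    (mul_le_mul (hK n) (hL _ n) (norm_nonneg _) ((norm_nonneg _).trans (hK n)))
    (by positivity) ((norm_nonneg _).trans (hnum i j k n))

theorem summable_qGaussTerm (hp : ‖p‖ < 1) (hab : ‖a * b‖ < 1)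
    (huv : ∀ k : ℕ, u * v * p ^ k ≠ 1) : Summable (qGaussTerm p a b u v) := by
  obtain ⟨B, hB, hle⟩ := exists_summable_norm_qGaussTerm_le hp hab huv
  exact .of_norm_bounded hB fun n => by simpa using hle 0 0 0 n

theorem qGaussTerm_contiguous (hp : ∀ k : ℕ, p * p ^ k ≠ 1) (huv : ∀ k : ℕ, u * v * p ^ k ≠ 1)
    (n : ℕ) :
    (1 - u * v) * (1 - a * b) * qGaussTerm p a b u v n -
        (1 - a * v) * (1 - b * u) * qGaussTerm p (a * p) b (u * p) v n =
      (1 - u * v) * (1 - p ^ n) * qGaussTerm p a b u v n -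
        (1 - u * v) * (1 - p ^ (n + 1)) * qGaussTerm p a b u v (n + 1) := by
  have hp_ne := qShift_ne_zero hp n
  have hp_last : 1 - p * p ^ n ≠ 0 := sub_ne_zero.mpr (hp n).symm
  have huv_ne := qShift_ne_zero huv n
  have huv_last : 1 - u * v * p ^ n ≠ 0 := sub_ne_zero.mpr (huv n).symm
  have huv_first : 1 - u * v ≠ 0 := by simpa using sub_ne_zero.mpr (huv 0).symm
  have hshift : qShift (u * p * v) p n =
      qShift (u * v) p n * (1 - u * v * p ^ n) / (1 - u * v) := by
    rw [eq_div_iff huv_first, ← qShift_succ, qShift_succ', mul_right_comm u v p, mul_comm]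
  simp only [qGaussTerm, qShiftHom_mul_mul, qShiftHom_succ, qShift_succ, hshift, pow_succ]
  rw [mul_comm p (p ^ n)] at hp_last ⊢
  generalize p ^ n = x at hp_last huv_last ⊢
  field_simp
  ring

theorem tsum_qGaussTerm_contiguous (hp : ‖p‖ < 1) (hab : ‖a * b‖ < 1)
    (huv : ∀ k : ℕ, u * v * p ^ k ≠ 1) :
    (1 - u * v) * (1 - a * b) * ∑' n, qGaussTerm p a b u v n =
      (1 - a * v) * (1 - b * u) * ∑' n, qGaussTerm p (a * p) b (u * p) v n := by
  have hs := summable_qGaussTerm hp hab huv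
  have hs' : Summable (qGaussTerm p (a * p) b (u * p) v) := by
    obtain ⟨B, hB, hle⟩ := exists_summable_norm_qGaussTerm_le hp hab huv
    exact .of_norm_bounded hB fun n => by simpa using hle 1 1 0 n
  set G : ℕ → ℂ := fun n => (1 - u * v) * (1 - p ^ n) * qGaussTerm p a b u v n with hG
  have hG_lim : Tendsto G atTop (𝓝 0) := by
    have hpow := tendsto_pow_atTop_nhds_zero_of_norm_lt_one hp
    simpa [hG] using ((hpow.const_sub 1).const_mul (1 - u * v)).mul hs.tendsto_atTop_zero
  have hdiff := (hs.hasSum.mul_left ((1 - u * v) * (1 - a * b))).sub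
    (hs'.hasSum.mul_left ((1 - a * v) * (1 - b * u)))
  simp only [qGaussTerm_contiguous (mul_pow_ne_one hp hp.le) huv] at hdiff
  have htelescope : Tendsto (fun N => ∑ n ∈ Finset.range N, (G n - G (n + 1))) atTop (𝓝 0) := by
    simp only [Finset.sum_range_sub']
    simpa [hG] using hG_lim.const_sub (G 0)
  exact sub_eq_zero.mp (tendsto_nhds_unique hdiff.tendsto_sum_nat htelescope)

theorem tsum_qGaussTerm_iterate (hp : ‖p‖ < 1) (hab : ‖a * b‖ < 1)
    (huv : ∀ k : ℕ, u * v * p ^ k ≠ 1) (N : ℕ) :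
    qShift (u * v) p N * qShift (a * b) p N * ∑' n, qGaussTerm p a b u v n =
      qShift (a * v) p N * qShift (b * u) p N *
        ∑' n, qGaussTerm p (a * p ^ N) b (u * p ^ N) v n := by
  induction N with
  | zero => simp [qShift_zero]
  | succ N ih =>
    have hab' : ‖a * p ^ N * b‖ < 1 := by
      rw [mul_right_comm, norm_mul, norm_pow]
      exact mul_lt_one_of_nonneg_of_lt_one_left (norm_nonneg _) hab
        (pow_le_one₀ (norm_nonneg p) hp.le)
    have huv' : ∀ k : ℕ, u * p ^ N * v * p ^ k ≠ 1 := fun k => by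
      rw [mul_right_comm u]
      exact mul_pow_mul_pow_ne_one huv N k
    have hstep := tsum_qGaussTerm_contiguous hp hab' huv'
    simp only [qShift_succ, pow_succ, ← mul_assoc]
    linear_combination (1 - u * v * p ^ N) * (1 - a * b * p ^ N) * ih +
      qShift (a * v) p N * qShift (b * u) p N * hstep

theorem tendsto_tsum_qGaussTerm_mul_pow (hp : ‖p‖ < 1) (hab : ‖a * b‖ < 1)
    (huv : ∀ k : ℕ, u * v * p ^ k ≠ 1) :
    Tendsto (fun N : ℕ => ∑' n, qGaussTerm p (a * p ^ N) b (u * p ^ N) v n) atTop (𝓝 1) := by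
  have hpow := tendsto_pow_atTop_nhds_zero_of_norm_lt_one hp
  have hterm : ∀ n, Tendsto (fun N : ℕ => qGaussTerm p (a * p ^ N) b (u * p ^ N) v n) atTop
      (𝓝 (qGaussTerm p 0 b 0 v n)) := fun n => by
    have hcont : ContinuousAt (fun x => qGaussTerm p (a * x) b (u * x) v n) 0 := by
      have hden : qShift p p n * qShift (u * 0 * v) p n ≠ 0 :=
        mul_ne_zero (qShift_ne_zero (mul_pow_ne_one hp hp.le) n) (by simp [qShift])
      unfold qGaussTerm qShiftHom
      refine .div (by fun_prop) ?_ hden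
      unfold qShift
      fun_prop
    simpa [Function.comp_def] using hcont.tendsto.comp hpow
  have hlim : ∑' n, qGaussTerm p 0 b 0 v n = 1 := by
    rw [tsum_eq_single 0 fun n hn => by simp [qGaussTerm, qShiftHom, hn]]
    simp [qGaussTerm, qShiftHom_zero, qShift_zero]
  obtain ⟨B, hB, hle⟩ := exists_summable_norm_qGaussTerm_le hp hab huv
  rw [← hlim]
  exact tendsto_tsum_of_dominated_convergence hB hterm
    (.of_forall fun N n => by simpa using hle N N 0 n)

/-- Heine's `q`-analogue of Gauss's summation theorem. -/
theorem qShiftInf_mul_tsum_qGaussTerm (hp : ‖p‖ < 1) (hab : ‖a * b‖ < 1)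
    (huv : ∀ k : ℕ, u * v * p ^ k ≠ 1) :
    qShiftInf (u * v) p * qShiftInf (a * b) p * ∑' n, qGaussTerm p a b u v n =
      qShiftInf (a * v) p * qShiftInf (b * u) p := by
  have hleft := ((tendsto_qShift (u * v) hp).mul (tendsto_qShift (a * b) hp)).mul_const
    (∑' n, qGaussTerm p a b u v n)
  have hright := ((tendsto_qShift (a * v) hp).mul (tendsto_qShift (b * u) hp)).mul
    (tendsto_tsum_qGaussTerm_mul_pow hp hab huv)
  rw [mul_one] at hright
  exact tendsto_nhds_unique (hleft.congr (tsum_qGaussTerm_iterate hp hab huv)) hright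

end QGauss

section Bailey

theorem hasSum_sum_antidiagonal {A M : Type*} [AddCommMonoid A] [Finset.HasAntidiagonal A]
    [AddCommMonoid M] [TopologicalSpace M] [ContinuousAdd M] [RegularSpace M] {f : A × A → M}
    {s : M} (hf : HasSum f s) :
    HasSum (fun n => ∑ x ∈ Finset.HasAntidiagonal.antidiagonal n, f x) s := by
  refine (Finset.HasAntidiagonal.sigmaAntidiagonalEquivProd.hasSum_iff.mpr hf).sigma fun n => ?_
  rw [← Finset.sum_coe_sort]
  exact hasSum_fintype _

/-- A Bailey pair relative to `c` in base `p`: Bailey's lemma turns each such pair into an identity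
between a series in `β` and a series in `α`. -/
def IsBaileyPair (p c : ℂ) (α β : ℕ → ℂ) : Prop :=
  ∀ n, β n = ∑ r ∈ Finset.range (n + 1), α r / (qShift p p (n - r) * qShift (c * p) p (n + r))

/-- The double series obtained by inserting the definition of a Bailey pair `(α, β)` into
`∑ qShiftHom a u p n * qShiftHom b v p n * β n`, indexed by `(r, n - r)`: for fixed `r` it is a
multiple of a `q`-Gauss series. -/
noncomputable def baileyTerm (p a b u v : ℂ) (α : ℕ → ℂ) (x : ℕ × ℕ) : ℂ :=
  α x.1 * (qShiftHom a u p x.1 * qShiftHom b v p x.1) / qShift (u * v) p (2 * x.1) *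
    qGaussTerm p a b (u * p ^ x.1) (v * p ^ x.1) x.2

variable {p a b u v c : ℂ} {α β : ℕ → ℂ}

theorem IsBaileyPair.mul_eq_sum_antidiagonal (h : IsBaileyPair p c α β) (hc : c * p = u * v)
    (n : ℕ) :
    qShiftHom a u p n * qShiftHom b v p n * β n =
      ∑ x ∈ Finset.HasAntidiagonal.antidiagonal n, baileyTerm p a b u v α x := by
  rw [h, hc, Finset.mul_sum,
    Finset.Nat.sum_antidiagonal_eq_sum_range_succ_mk (baileyTerm p a b u v α)]
  refine Finset.sum_congr rfl fun r hr => ?_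
  obtain ⟨m, rfl⟩ := Nat.exists_eq_add_of_le (Finset.mem_range_succ_iff.mp hr)
  rw [Nat.add_sub_cancel_left, add_right_comm, ← two_mul, baileyTerm, qGaussTerm, qShiftHom_add,
    qShiftHom_add, qShift_add, mul_mul_mul_comm u, ← pow_add, ← two_mul]
  ring

theorem summable_baileyTerm (hp : ‖p‖ < 1) (hab : ‖a * b‖ < 1)
    (huv : ∀ k : ℕ, u * v * p ^ k ≠ 1)
    (hα : Summable fun r => α r * (qShiftHom a u p r * qShiftHom b v p r)) :
    Summable (baileyTerm p a b u v α) := by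
  obtain ⟨B, hB, hle⟩ := exists_summable_norm_qGaussTerm_le hp hab huv
  obtain ⟨K, hK⟩ := exists_norm_inv_qShift_le huv hp
  have hB_nonneg : 0 ≤ B := fun n => (norm_nonneg _).trans (hle 0 0 0 n)
  refine .of_norm_bounded ((hα.norm.mul_right K).mul_of_nonneg hB (fun r => ?_) hB_nonneg)
    fun x => ?_
  · exact mul_nonneg (norm_nonneg _) ((norm_nonneg _).trans (hK 0))
  · rw [baileyTerm, div_eq_mul_inv, norm_mul, norm_mul _ (qShift _ _ _)⁻¹]
    gcongr
    · exact mul_nonneg (norm_nonneg _) ((norm_nonneg _).trans (hK 0))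
    · exact hK _
    · simpa using hle 0 x.1 x.1 x.2

theorem tsum_baileyTerm (hp : ‖p‖ < 1) (hab : ‖a * b‖ < 1) (huv : ∀ k : ℕ, u * v * p ^ k ≠ 1)
    (hav : ∀ k : ℕ, a * v * p ^ k ≠ 1) (hbu : ∀ k : ℕ, b * u * p ^ k ≠ 1) (r : ℕ) :
    qShiftInf (u * v) p * qShiftInf (a * b) p * ∑' m, baileyTerm p a b u v α (r, m) =
      qShiftInf (a * v) p * qShiftInf (b * u) p * (α r * (qShiftHom a u p r * qShiftHom b v p r /
        (qShift (a * v) p r * qShift (b * u) p r))) := by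
  have hprod : u * p ^ r * (v * p ^ r) = u * v * p ^ (2 * r) := by ring
  have hgauss := qShiftInf_mul_tsum_qGaussTerm (u := u * p ^ r) (v := v * p ^ r) hp hab fun k => by
    rw [hprod]
    exact mul_pow_mul_pow_ne_one huv _ k
  rw [hprod, ← mul_assoc a, ← mul_assoc b] at hgauss
  have huv_ne := qShift_ne_zero huv (2 * r)
  have hav_ne := qShift_ne_zero hav r
  have hbu_ne := qShift_ne_zero hbu r
  simp only [baileyTerm, tsum_mul_left]
  rw [qShiftInf_eq_qShift_mul (u * v) hp (2 * r), qShiftInf_eq_qShift_mul (a * v) hp r,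
    qShiftInf_eq_qShift_mul (b * u) hp r]
  generalize qShift (a * v) p r = x at *
  generalize qShift (b * u) p r = y at *
  generalize qShiftInf (a * v * p ^ r) p = X at *
  generalize qShiftInf (b * u * p ^ r) p = Y at *
  field_simp
  linear_combination α r * qShiftHom a u p r * qShiftHom b v p r * hgauss

theorem IsBaileyPair.summable_qShiftHom_mul (h : IsBaileyPair p c α β) (hc : c * p = u * v)
    (hp : ‖p‖ < 1) (hab : ‖a * b‖ < 1) (huv : ∀ k : ℕ, u * v * p ^ k ≠ 1)
    (hα : Summable fun r => α r * (qShiftHom a u p r * qShiftHom b v p r)) :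
    Summable fun n => qShiftHom a u p n * qShiftHom b v p n * β n := by
  simp only [h.mul_eq_sum_antidiagonal hc]
  exact (hasSum_sum_antidiagonal (summable_baileyTerm hp hab huv hα).hasSum).summable

/-- Bailey's lemma, in the limiting form that equates two infinite series. -/
theorem IsBaileyPair.tsum_qShiftHom_mul (h : IsBaileyPair p c α β) (hc : c * p = u * v)
    (hp : ‖p‖ < 1) (hab : ‖a * b‖ < 1) (huv : ∀ k : ℕ, u * v * p ^ k ≠ 1)
    (hav : ∀ k : ℕ, a * v * p ^ k ≠ 1) (hbu : ∀ k : ℕ, b * u * p ^ k ≠ 1)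
    (hα : Summable fun r => α r * (qShiftHom a u p r * qShiftHom b v p r)) :
    qShiftInf (u * v) p * qShiftInf (a * b) p *
        ∑' n, qShiftHom a u p n * qShiftHom b v p n * β n =
      qShiftInf (a * v) p * qShiftInf (b * u) p *
        ∑' r, α r * (qShiftHom a u p r * qShiftHom b v p r /
          (qShift (a * v) p r * qShift (b * u) p r)) := by
  have hs := summable_baileyTerm hp hab huv hα
  simp only [h.mul_eq_sum_antidiagonal hc]
  rw [(hasSum_sum_antidiagonal hs.hasSum).tsum_eq, hs.tsum_prod, ← tsum_mul_left, ← tsum_mul_left]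
  exact tsum_congr fun r => tsum_baileyTerm hp hab huv hav hbu r

theorem summable_mul_div_qShift {f : ℕ → ℂ} {x y : ℂ} (hf : Summable f) (hp : ‖p‖ < 1)
    (hx : ∀ k : ℕ, x * p ^ k ≠ 1) (hy : ∀ k : ℕ, y * p ^ k ≠ 1) :
    Summable fun r => f r / (qShift x p r * qShift y p r) := by
  obtain ⟨K, hK⟩ := exists_norm_inv_qShift_le hx hp
  obtain ⟨L, hL⟩ := exists_norm_inv_qShift_le hy hp
  refine .of_norm_bounded (hf.norm.mul_right (K * L)) fun r => ?_
  rw [div_eq_mul_inv, mul_inv, norm_mul, norm_mul (_)⁻¹]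
  gcongr
  exacts [(norm_nonneg _).trans (hK 0), hK r, hL r]

end Bailey

section SlaterSum

/-- The reciprocal `1 / (p; p)_k`, extended by zero to negative `k`. -/
noncomputable def qFactorialInv (p : ℂ) (k : ℤ) : ℂ :=
  if 0 ≤ k then (qShift p p k.toNat)⁻¹ else 0

/-- The bilateral sum `∑ (-1)^n p^(3n²+jn) / ((p; p)_{M-2n} (p; p)_{N+2n})`, which has finitely
many nonzero terms. It is a multiple of an alternating sum of the `q`-binomial coefficients of
degree `M + N`. The exponents may be negative for general `j`, so `p = 0` is degenerate. -/
noncomputable def slaterSum (p : ℂ) (j M N : ℤ) : ℂ :=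
  ∑' n : ℤ, (-1) ^ n * p ^ (3 * n ^ 2 + j * n) *
    (qFactorialInv p (M - 2 * n) * qFactorialInv p (N + 2 * n))

variable {p : ℂ}

theorem qFactorialInv_natCast (p : ℂ) (n : ℕ) : qFactorialInv p n = (qShift p p n)⁻¹ := by
  simp [qFactorialInv]

theorem qFactorialInv_of_neg (p : ℂ) {k : ℤ} (hk : k < 0) : qFactorialInv p k = 0 := by
  simp [qFactorialInv, hk]

theorem qFactorialInv_sub_one (hp : ∀ k : ℕ, p * p ^ k ≠ 1) (k : ℤ) :
    qFactorialInv p (k - 1) = (1 - p ^ k) * qFactorialInv p k := by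
  rcases lt_trichotomy k 0 with hk | rfl | hk
  · rw [qFactorialInv_of_neg p hk, qFactorialInv_of_neg p (by lia), mul_zero]
  · simp [qFactorialInv]
  · obtain ⟨n, rfl⟩ : ∃ n : ℕ, k = (n + 1 : ℕ) := ⟨(k - 1).toNat, by lia⟩
    have hlast : 1 - p * p ^ n ≠ 0 := sub_ne_zero.mpr (hp n).symm
    rw [Nat.cast_succ, add_sub_cancel_right, ← Nat.cast_succ, qFactorialInv_natCast,
      qFactorialInv_natCast, qShift_succ, zpow_natCast, pow_succ', mul_inv, mul_comm,
      inv_mul_cancel_right₀ hlast]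

theorem qFactorialInv_pascal (hp : ∀ k : ℕ, p * p ^ k ≠ 1) (hp0 : p ≠ 0) (j k : ℤ) :
    (1 - p ^ (j + k)) * (qFactorialInv p j * qFactorialInv p k) =
      qFactorialInv p (j - 1) * qFactorialInv p k +
        p ^ j * (qFactorialInv p j * qFactorialInv p (k - 1)) := by
  rw [qFactorialInv_sub_one hp, qFactorialInv_sub_one hp, zpow_add₀ hp0]
  ring

theorem summable_mul_qFactorialInv (p : ℂ) (w : ℤ → ℂ) (M N : ℤ) :
    Summable fun n : ℤ => w n * (qFactorialInv p (M - 2 * n) * qFactorialInv p (N + 2 * n)) := by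
  refine summable_of_ne_finset_zero (s := Finset.Icc (-|N|) |M|) fun n hn => ?_
  rw [Finset.mem_Icc, not_and_or, not_le, not_le] at hn
  rcases hn with hn | hn
  · rw [qFactorialInv_of_neg p (show N + 2 * n < 0 by grind), mul_zero, mul_zero]
  · rw [qFactorialInv_of_neg p (show M - 2 * n < 0 by grind), zero_mul, mul_zero]

theorem slaterSum_neg (p : ℂ) (j M N : ℤ) : slaterSum p (-j) M N = slaterSum p j N M := by
  rw [slaterSum, ← (Equiv.neg ℤ).tsum_eq]
  refine tsum_congr fun n => ?_
  rw [Equiv.neg_apply, neg_sq, neg_mul_neg, mul_neg, sub_neg_eq_add, ← sub_eq_add_neg,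
    mul_comm (qFactorialInv p (M + _)), zpow_neg, ← inv_zpow, inv_neg_one]

theorem slaterSum_three_eq_zero (p : ℂ) {M N : ℤ} (h : N = M + 2) : slaterSum p 3 M N = 0 := by
  refine self_eq_neg.mp ?_
  conv_lhs => rw [slaterSum, ← (Equiv.subLeft (-1 : ℤ)).tsum_eq]
  rw [slaterSum, ← tsum_neg]
  refine tsum_congr fun n => ?_
  have hsign : (-1 : ℂ) ^ (-1 - n) = -(-1) ^ n := by
    rw [zpow_sub₀ (by norm_num), zpow_neg_one, inv_neg_one, div_eq_mul_inv, ← inv_zpow,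
      inv_neg_one, neg_one_mul]
  rw [Equiv.subLeft_apply, hsign, show 3 * (-1 - n) ^ 2 + 3 * (-1 - n) = 3 * n ^ 2 + 3 * n by ring,
    show M - 2 * (-1 - n) = N + 2 * n by lia, show N + 2 * (-1 - n) = M - 2 * n by lia]
  ring

theorem slaterSum_pascal (hp : ∀ k : ℕ, p * p ^ k ≠ 1) (hp0 : p ≠ 0) (j M N : ℤ) :
    (1 - p ^ (M + N)) * slaterSum p j M N =
      slaterSum p j (M - 1) N + p ^ M * slaterSum p (j - 2) M (N - 1) := by
  simp only [slaterSum]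
  rw [← tsum_mul_left, ← tsum_mul_left, ← (summable_mul_qFactorialInv p _ _ _).tsum_add
    ((summable_mul_qFactorialInv p _ _ _).mul_left _)]
  refine tsum_congr fun n => ?_
  have hpascal := qFactorialInv_pascal hp hp0 (M - 2 * n) (N + 2 * n)
  have hweight : p ^ (3 * n ^ 2 + j * n) * p ^ (M - 2 * n) =
      p ^ M * p ^ (3 * n ^ 2 + (j - 2) * n) := by
    rw [← zpow_add₀ hp0, ← zpow_add₀ hp0]
    congr 1
    ring
  rw [show M - 2 * n + (N + 2 * n) = M + N by ring, sub_right_comm M,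
    add_sub_right_comm N] at hpascal
  linear_combination (-1) ^ n * p ^ (3 * n ^ 2 + j * n) * hpascal +
    (-1) ^ n * qFactorialInv p (M - 2 * n) * qFactorialInv p (N - 1 + 2 * n) * hweight

theorem slaterSum_pascal' (hp : ∀ k : ℕ, p * p ^ k ≠ 1) (hp0 : p ≠ 0) (j M N : ℤ) :
    (1 - p ^ (M + N)) * slaterSum p j M N =
      slaterSum p j M (N - 1) + p ^ N * slaterSum p (j + 2) (M - 1) N := by
  have h := slaterSum_pascal hp hp0 (-j) N M
  rwa [show -j - 2 = -(j + 2) by ring, slaterSum_neg, slaterSum_neg, slaterSum_neg,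
    add_comm N] at h

theorem slaterSum_one_self_succ (hp : ∀ k : ℕ, p * p ^ k ≠ 1) (hp0 : p ≠ 0) (N : ℕ) :
    slaterSum p 1 N (N + 1) = slaterSum p 1 N N / (1 - p * p ^ (2 * N)) := by
  have h := slaterSum_pascal' hp hp0 1 N (N + 1)
  rw [show (1 + 2 : ℤ) = 3 by norm_num, slaterSum_three_eq_zero p (by ring), mul_zero, add_zero,
    add_sub_cancel_right, show (N + (N + 1) : ℤ) = (2 * N + 1 : ℕ) by push_cast; ring,
    zpow_natCast, pow_succ', mul_comm] at h
  exact eq_div_of_mul_eq (sub_ne_zero.mpr (hp _).symm) h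

theorem slaterSum_three_self_succ (hp : ∀ k : ℕ, p * p ^ k ≠ 1) (hp0 : p ≠ 0) (N : ℕ) :
    slaterSum p 3 N (N + 1) = p ^ N * slaterSum p 1 N N / (1 - p * p ^ (2 * N)) := by
  have h := slaterSum_pascal hp hp0 3 N (N + 1)
  have hzero : slaterSum p 3 (N - 1) (N + 1) = 0 := slaterSum_three_eq_zero p (by ring)
  rw [show (3 - 2 : ℤ) = 1 by norm_num, hzero, zero_add,
    add_sub_cancel_right, show (N + (N + 1) : ℤ) = (2 * N + 1 : ℕ) by push_cast; ring,
    zpow_natCast, zpow_natCast, pow_succ', mul_comm] at h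
  exact eq_div_of_mul_eq (sub_ne_zero.mpr (hp _).symm) h

theorem slaterSum_one_succ_succ (hp : ∀ k : ℕ, p * p ^ k ≠ 1) (hp0 : p ≠ 0) (N : ℕ) :
    slaterSum p 1 (N + 1) (N + 1) =
      (1 + p * p ^ N) * slaterSum p 1 N (N + 1) / (1 - p * p ^ (2 * N + 1)) := by
  have h := slaterSum_pascal hp hp0 1 (N + 1) (N + 1)
  rw [show (1 - 2 : ℤ) = -1 by norm_num, slaterSum_neg, add_sub_cancel_right,
    show (N + 1 + (N + 1) : ℤ) = (2 * N + 1 + 1 : ℕ) by push_cast; ring, ← Nat.cast_succ N,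
    zpow_natCast, zpow_natCast, pow_succ', pow_succ'] at h
  rw [← Nat.cast_succ N, eq_div_iff (sub_ne_zero.mpr (hp _).symm)]
  rw [Nat.succ_eq_add_one, pow_succ'] at h
  linear_combination h

theorem slaterSum_one_zero_zero (p : ℂ) : slaterSum p 1 0 0 = 1 := by
  rw [slaterSum, tsum_eq_single 0]
  · simp [qFactorialInv, qShift]
  · intro n hn
    rcases lt_or_gt_of_ne hn with h | h
    · rw [qFactorialInv_of_neg p (show 0 + 2 * n < 0 by lia), mul_zero, mul_zero]
    · rw [qFactorialInv_of_neg p (show 0 - 2 * n < 0 by lia), zero_mul, mul_zero]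

theorem slaterSum_one_self (hp : ∀ k : ℕ, p * p ^ k ≠ 1) (hp0 : p ≠ 0) (N : ℕ) :
    slaterSum p 1 N N = qShift (-p) p N / qShift p p (2 * N) := by
  induction N with
  | zero => simpa [qShift_zero] using slaterSum_one_zero_zero p
  | succ N ih =>
    rw [Nat.cast_succ, slaterSum_one_succ_succ hp hp0, slaterSum_one_self_succ hp hp0, ih,
      mul_add_one, qShift_succ, qShift_succ, qShift_succ, div_div, mul_div_assoc', div_div]
    ring

end SlaterSum

section SlaterPair

/-- Slater's sequence `α_{2n} = (-1)^n (1 + q^(4n+1)) q^(6n²+2n)`,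
`α_{2n+1} = -(-1)^n (1 + q^(4n+3)) q^(6n²+6n+1)`, the first half of a Bailey pair in base `q²`. -/
noncomputable def slaterAlpha (q : ℂ) (r : ℕ) : ℂ :=
  if Even r then (-1) ^ (r / 2) * (1 + q ^ (4 * (r / 2) + 1)) * q ^ (6 * (r / 2) ^ 2 + 2 * (r / 2))
  else -((-1) ^ (r / 2) * (1 + q ^ (4 * (r / 2) + 3)) * q ^ (6 * (r / 2) ^ 2 + 6 * (r / 2) + 1))

/-- The second half `(1 - q²) / ((-q, q²; q²)_n (q; q²)_{n+1})` of Slater's Bailey pair. -/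
noncomputable def slaterBeta (q : ℂ) (n : ℕ) : ℂ :=
  (1 - q ^ 2) / (qShift (-q) (q ^ 2) n * qShift (q ^ 2) (q ^ 2) n * qShift q (q ^ 2) (n + 1))

variable {q : ℂ}

theorem slaterAlpha_two_mul (q : ℂ) (n : ℕ) :
    slaterAlpha q (2 * n) = (-1) ^ n * (1 + q ^ (4 * n + 1)) * q ^ (6 * n ^ 2 + 2 * n) := by
  simp [slaterAlpha]

theorem slaterAlpha_two_mul_add_one (q : ℂ) (n : ℕ) :
    slaterAlpha q (2 * n + 1) =
      -((-1) ^ n * (1 + q ^ (4 * n + 3)) * q ^ (6 * n ^ 2 + 6 * n + 1)) := by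
  have hdiv : (2 * n + 1) / 2 = n := by lia
  simp [slaterAlpha, hdiv]

theorem norm_slaterAlpha_le (hq : ‖q‖ ≤ 1) (r : ℕ) : ‖slaterAlpha q r‖ ≤ 2 := by
  have hpow : ∀ m : ℕ, ‖q ^ m‖ ≤ 1 := fun m => by
    rw [norm_pow]
    exact pow_le_one₀ (norm_nonneg q) hq
  have hterm : ∀ k m n : ℕ, ‖(-1) ^ k * (1 + q ^ m) * q ^ n‖ ≤ 2 := fun k m n => by
    rw [norm_mul, norm_mul, norm_pow, norm_neg, norm_one, one_pow, one_mul, ← mul_one 2]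
    gcongr
    · exact (norm_add_le_of_le norm_one.le (hpow m)).trans_eq one_add_one_eq_two
    · exact hpow n
  unfold slaterAlpha
  split_ifs
  · exact hterm _ _ _
  · rw [norm_neg]
    exact hterm _ _ _

/-- The combined weight of `slaterSum (q²) 1` and `q * slaterSum (q²) 3`. It is the bilateral form
of `slaterAlpha q`, with `n ≥ 0` standing for `r = 2n` and `n < 0` for `r = -2n - 1`. -/
noncomputable def slaterWeight (q : ℂ) (n : ℤ) : ℂ :=
  (-1) ^ n * (q ^ 2) ^ (3 * n ^ 2 + 1 * n) + q * ((-1) ^ n * (q ^ 2) ^ (3 * n ^ 2 + 3 * n))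

theorem slaterWeight_natCast (q : ℂ) (n : ℕ) : slaterWeight q n = slaterAlpha q (2 * n) := by
  rw [slaterWeight, slaterAlpha_two_mul,
    show 3 * (n : ℤ) ^ 2 + 1 * n = (3 * n ^ 2 + n : ℕ) by push_cast; ring,
    show 3 * (n : ℤ) ^ 2 + 3 * n = (3 * n ^ 2 + 3 * n : ℕ) by push_cast; ring]
  simp only [zpow_natCast]
  ring

theorem slaterWeight_neg_succ (q : ℂ) (n : ℕ) :
    slaterWeight q (-(n + 1)) = slaterAlpha q (2 * n + 1) := by
  rw [slaterWeight, slaterAlpha_two_mul_add_one,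
    show 3 * (-(n + 1 : ℤ)) ^ 2 + 1 * -(n + 1 : ℤ) = (3 * n ^ 2 + 5 * n + 2 : ℕ) by
      push_cast; ring,
    show 3 * (-(n + 1 : ℤ)) ^ 2 + 3 * -(n + 1 : ℤ) = (3 * n ^ 2 + 3 * n : ℕ) by push_cast; ring,
    zpow_neg, ← inv_zpow, inv_neg_one, zpow_add_one₀ (by norm_num)]
  simp only [zpow_natCast]
  ring

theorem tsum_slaterWeight_mul (q : ℂ) (M N : ℤ) :
    ∑' n : ℤ, slaterWeight q n *
        (qFactorialInv (q ^ 2) (M - 2 * n) * qFactorialInv (q ^ 2) (N + 2 * n)) =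
      slaterSum (q ^ 2) 1 M N + q * slaterSum (q ^ 2) 3 M N := by
  simp only [slaterWeight, add_mul, mul_assoc q]
  rw [(summable_mul_qFactorialInv _ _ M N).tsum_add
    ((summable_mul_qFactorialInv _ _ M N).mul_left q), tsum_mul_left, slaterSum, slaterSum]

theorem sum_slaterAlpha_mul_qFactorialInv (q : ℂ) (N : ℕ) :
    ∑ r ∈ Finset.range (N + 1), slaterAlpha q r *
        (qFactorialInv (q ^ 2) (N - r) * qFactorialInv (q ^ 2) (N + r + 1)) =
      slaterSum (q ^ 2) 1 N (N + 1) + q * slaterSum (q ^ 2) 3 N (N + 1) := by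
  set g : ℕ → ℂ := fun r => slaterAlpha q r *
    (qFactorialInv (q ^ 2) (N - r) * qFactorialInv (q ^ 2) (N + r + 1)) with hg
  set f : ℤ → ℂ := fun n => slaterWeight q n *
    (qFactorialInv (q ^ 2) (N - 2 * n) * qFactorialInv (q ^ 2) (N + 1 + 2 * n)) with hf
  have hf_summable : Summable f := summable_mul_qFactorialInv _ _ _ _
  have heven : ∀ n : ℕ, f n = g (2 * n) := fun n => by
    simp only [hf, hg, slaterWeight_natCast]
    rw [Nat.cast_mul, Nat.cast_ofNat, add_right_comm]
  have hodd : ∀ n : ℕ, f (-(n + 1)) = g (2 * n + 1) := fun n => by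
    simp only [hf, hg, slaterWeight_neg_succ]
    rw [show (N - 2 * -(n + 1 : ℤ)) = N + (2 * n + 1 : ℕ) + 1 by push_cast; ring,
      show (N + 1 + 2 * -(n + 1 : ℤ)) = N - (2 * n + 1 : ℕ) by push_cast; ring,
      mul_comm (qFactorialInv _ _)]
  have hf_nat := hf_summable.comp_injective Nat.cast_injective
  have hf_neg : Summable fun n : ℕ => f (-(n + 1)) :=
    hf_summable.comp_injective (i := fun n : ℕ => -(n + 1 : ℤ)) fun m n h => by simpa using h
  rw [← tsum_slaterWeight_mul, tsum_of_nat_of_neg_add_one hf_nat hf_neg, tsum_congr heven,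
    tsum_congr hodd, tsum_even_add_odd (hf_nat.congr heven) (hf_neg.congr hodd), tsum_eq_sum]
  intro r hr
  simp only [hg]
  rw [qFactorialInv_of_neg _ (by grind), zero_mul, mul_zero]

theorem slaterSum_add_mul_slaterSum (hq : ∀ k : ℕ, q ^ 2 * (q ^ 2) ^ k ≠ 1) (hq0 : q ≠ 0) (N : ℕ) :
    slaterSum (q ^ 2) 1 N (N + 1) + q * slaterSum (q ^ 2) 3 N (N + 1) =
      1 / (qShift (-q) (q ^ 2) N * qShift (q ^ 2) (q ^ 2) N * qShift q (q ^ 2) (N + 1)) := by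
  have hp0 := pow_ne_zero 2 hq0
  have hfactor : qShift (q ^ 2) (q ^ 2) (2 * N + 1) =
      qShift q (q ^ 2) (N + 1) * (qShift (-q) (q ^ 2) N * (1 + q * (q ^ 2) ^ N)) *
        (qShift (q ^ 2) (q ^ 2) N * qShift (-q ^ 2) (q ^ 2) N) := by
    rw [qShift_two_mul_add_one, ← qShift_mul_qShift_neg q, ← sq, ← qShift_mul_qShift_neg (q ^ 2),
      qShift_succ (-q), neg_mul, sub_neg_eq_add]
  have hne := qShift_ne_zero hq (2 * N + 1)
  rw [slaterSum_one_self_succ hq hp0, slaterSum_three_self_succ hq hp0, slaterSum_one_self hq hp0]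
  calc _ = (1 + q * (q ^ 2) ^ N) * qShift (-q ^ 2) (q ^ 2) N /
        qShift (q ^ 2) (q ^ 2) (2 * N + 1) := by
        rw [qShift_succ, div_div, mul_div_assoc (_ ^ N), div_div]
        ring
    _ = _ := by
        rw [hfactor] at hne ⊢
        simp only [ne_eq, mul_eq_zero, not_or] at hne
        obtain ⟨⟨hq_ne, hneg_ne, hlast_ne⟩, hp_ne, hneg_p_ne⟩ := hne
        field_simp

theorem isBaileyPair_slater (hq : ∀ k : ℕ, q ^ 2 * (q ^ 2) ^ k ≠ 1) :
    IsBaileyPair (q ^ 2) (q ^ 2) (slaterAlpha q) (slaterBeta q) := by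
  intro N
  rcases eq_or_ne q 0 with rfl | hq0
  · rw [Finset.sum_eq_single 0]
    · simp [slaterAlpha, slaterBeta, qShift]
    · intro r _ hr
      obtain ⟨n, rfl | rfl⟩ := r.even_or_odd'
      · rw [slaterAlpha_two_mul, zero_pow (n := 6 * n ^ 2 + 2 * n) (by lia), mul_zero, zero_div]
      · simp [slaterAlpha_two_mul_add_one]
    · simp
  · have hfirst : 1 - q ^ 2 ≠ 0 := by simpa using sub_ne_zero.mpr (hq 0).symm
    rw [slaterBeta, ← mul_one_div, ← slaterSum_add_mul_slaterSum hq hq0,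
      ← sum_slaterAlpha_mul_qFactorialInv, Finset.mul_sum]
    refine Finset.sum_congr rfl fun r hr => ?_
    rw [← Nat.cast_sub (Finset.mem_range_succ_iff.mp hr), ← Nat.cast_add, ← Nat.cast_succ,
      qFactorialInv_natCast, qFactorialInv_natCast, Nat.succ_eq_add_one, qShift_succ', mul_inv]
    field_simp

end SlaterPair

section SlaterTransformation

variable {q a b : ℂ}

theorem norm_sq_lt_one (hq : ‖q‖ < 1) : ‖q ^ 2‖ < 1 := by
  rw [norm_pow]
  exact pow_lt_one₀ (norm_nonneg q) hq two_ne_zero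

theorem summable_slaterAlpha_mul_qShiftScaled (hq : ‖q‖ < 1) (hab : ‖a * b‖ < 1) :
    Summable fun r => slaterAlpha q r * (qShiftScaled a (q ^ 2) r * qShiftScaled b (q ^ 2) r) := by
  simp only [← qShiftHom_self]
  refine .of_norm_bounded
    ((summable_qShiftHom_mul (q ^ 2) (q ^ 2) (norm_sq_lt_one hq) hab).norm.mul_left 2) fun r => ?_
  rw [norm_mul]
  gcongr
  exact norm_slaterAlpha_le hq.le r

theorem one_sub_sq_ne_zero (hq : ‖q‖ < 1) : 1 - q ^ 2 ≠ 0 :=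
  sub_ne_zero.mpr fun h => (norm_sq_lt_one hq).ne (by rw [← h, norm_one])

theorem sq_mul_sq_mul_pow_ne_one (hq : ‖q‖ < 1) (k : ℕ) : q ^ 2 * q ^ 2 * (q ^ 2) ^ k ≠ 1 := by
  have hp := norm_sq_lt_one hq
  simpa only [pow_one] using mul_pow_mul_pow_ne_one (mul_pow_ne_one hp hp.le) 1 k

theorem div_eq_mul_slaterBeta (hq : ‖q‖ < 1) (x : ℂ) (n : ℕ) :
    x / (qShift (-q) (q ^ 2) n * qShift (q ^ 2) (q ^ 2) n * qShift q (q ^ 2) (n + 1)) =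
      (1 - q ^ 2)⁻¹ * (x * slaterBeta q n) := by
  rw [slaterBeta, mul_left_comm, ← mul_div_assoc, inv_mul_cancel₀ (one_sub_sq_ne_zero hq),
    mul_one_div]

theorem summable_qShiftScaled_mul_div (hq : ‖q‖ < 1) (hab : ‖a * b‖ < 1) :
    Summable fun n => qShiftScaled a (q ^ 2) n * qShiftScaled b (q ^ 2) n /
      (qShift (-q) (q ^ 2) n * qShift (q ^ 2) (q ^ 2) n * qShift q (q ^ 2) (n + 1)) := by
  have hp := norm_sq_lt_one hq
  have hα := summable_slaterAlpha_mul_qShiftScaled hq hab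
  simp only [div_eq_mul_slaterBeta hq, ← qShiftHom_self] at hα ⊢
  exact ((isBaileyPair_slater (mul_pow_ne_one hp hp.le)).summable_qShiftHom_mul rfl hp hab
    (sq_mul_sq_mul_pow_ne_one hq) hα).mul_left _

theorem tsum_qShiftScaled_mul_div (hq : ‖q‖ < 1)
    (ha : ∀ k : ℕ, a * q ^ 2 * (q ^ 2) ^ k ≠ 1) (hb : ∀ k : ℕ, b * q ^ 2 * (q ^ 2) ^ k ≠ 1)
    (hab : ‖a * b‖ < 1) :
    qShiftInf (q ^ 2) (q ^ 2) * qShiftInf (a * b) (q ^ 2) /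
        (qShiftInf (a * q ^ 2) (q ^ 2) * qShiftInf (b * q ^ 2) (q ^ 2)) *
      ∑' n, qShiftScaled a (q ^ 2) n * qShiftScaled b (q ^ 2) n /
        (qShift (-q) (q ^ 2) n * qShift (q ^ 2) (q ^ 2) n * qShift q (q ^ 2) (n + 1)) =
      ∑' r, slaterAlpha q r * (qShiftScaled a (q ^ 2) r * qShiftScaled b (q ^ 2) r /
        (qShift (a * q ^ 2) (q ^ 2) r * qShift (b * q ^ 2) (q ^ 2) r)) := by
  have hp := norm_sq_lt_one hq
  have hfirst := one_sub_sq_ne_zero hq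
  have hα := summable_slaterAlpha_mul_qShiftScaled hq hab
  have hfactor : qShiftInf (q ^ 2) (q ^ 2) = (1 - q ^ 2) * qShiftInf (q ^ 2 * q ^ 2) (q ^ 2) := by
    simpa [qShift] using qShiftInf_eq_qShift_mul (q ^ 2) hp 1
  simp only [← qShiftHom_self] at hα
  have hbailey := (isBaileyPair_slater (mul_pow_ne_one hp hp.le)).tsum_qShiftHom_mul rfl hp hab
    (sq_mul_sq_mul_pow_ne_one hq) ha hb hα
  simp only [qShiftHom_self] at hbailey
  simp only [div_eq_mul_slaterBeta hq, tsum_mul_left]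
  rw [div_mul_eq_mul_div, div_eq_iff (mul_ne_zero (qShiftInf_ne_zero ha hp)
    (qShiftInf_ne_zero hb hp)), mul_comm (∑' _, slaterAlpha _ _ * _), ← hbailey, hfactor]
  field_simp

theorem summable_slaterAlpha_mul_div (hq : ‖q‖ < 1)
    (ha : ∀ k : ℕ, a * q ^ 2 * (q ^ 2) ^ k ≠ 1) (hb : ∀ k : ℕ, b * q ^ 2 * (q ^ 2) ^ k ≠ 1)
    (hab : ‖a * b‖ < 1) :
    Summable fun r => slaterAlpha q r * (qShiftScaled a (q ^ 2) r * qShiftScaled b (q ^ 2) r /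
      (qShift (a * q ^ 2) (q ^ 2) r * qShift (b * q ^ 2) (q ^ 2) r)) :=
  (summable_mul_div_qShift (summable_slaterAlpha_mul_qShiftScaled hq hab) (norm_sq_lt_one hq)
    ha hb).congr fun _ => mul_div_assoc _ _ _

theorem slaterAlpha_two_mul_mul (q x : ℂ) (n : ℕ) :
    slaterAlpha q (2 * n) * x =
      (-1) ^ n * (1 + q ^ (4 * n + 1)) * x * q ^ (6 * n ^ 2 + 2 * n) := by
  rw [slaterAlpha_two_mul, mul_right_comm]

theorem neg_slaterAlpha_two_mul_add_one_mul (q x : ℂ) (n : ℕ) :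
    -(slaterAlpha q (2 * n + 1) * x) =
      (-1) ^ n * (1 + q ^ (4 * n + 3)) * x * q ^ (6 * n ^ 2 + 6 * n + 1) := by
  rw [slaterAlpha_two_mul_add_one, neg_mul, neg_neg, mul_right_comm]

theorem tsum_even_sub_tsum_neg_odd {M : Type*} [AddCommGroup M] [UniformSpace M]
    [IsUniformAddGroup M] [CompleteSpace M] [T2Space M] {f : ℕ → M} (hf : Summable f) :
    ∑' n, f (2 * n) - ∑' n, -f (2 * n + 1) = ∑' n, f n := by
  rw [tsum_neg, sub_neg_eq_add]
  exact tsum_even_add_odd (hf.comp_injective (mul_right_injective₀ (two_ne_zero' ℕ)))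
    (hf.comp_injective ((add_left_injective 1).comp (mul_right_injective₀ (two_ne_zero' ℕ))))

theorem qShiftScaled_mul_qShiftScaled_div (ha : a ≠ 0) (hb : b ≠ 0) (p x : ℂ) (n : ℕ) :
    qShiftScaled a p n * qShiftScaled b p n / x =
      qShift (p / a) p n * qShift (p / b) p n / x * a ^ n * b ^ n := by
  rw [qShiftScaled_of_ne_zero ha, qShiftScaled_of_ne_zero hb]
  ring

end SlaterTransformation

theorem theoremT9_general (q a b : ℂ) (hq : ‖q‖ < 1) (ha : ∀ k : ℕ, a * q ^ 2 * (q ^ 2) ^ k ≠ 1)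
    (hb : ∀ k : ℕ, b * q ^ 2 * (q ^ 2) ^ k ≠ 1) (hab : ‖a * b‖ < 1) :
    (a ≠ 0 → b ≠ 0 →
      Summable (fun n : ℕ =>
        qShift (q ^ 2 / a) (q ^ 2) n * qShift (q ^ 2 / b) (q ^ 2) n /
          (qShift (-q) (q ^ 2) n * qShift (q ^ 2) (q ^ 2) n * qShift q (q ^ 2) (n + 1)) *
          a ^ n * b ^ n) ∧
      Summable (fun n : ℕ =>
        (-1) ^ n * (1 + q ^ (4 * n + 1)) *
          (qShift (q ^ 2 / a) (q ^ 2) (2 * n) * qShift (q ^ 2 / b) (q ^ 2) (2 * n) /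
            (qShift (a * q ^ 2) (q ^ 2) (2 * n) * qShift (b * q ^ 2) (q ^ 2) (2 * n))) *
          (a * b) ^ (2 * n) * q ^ (6 * n ^ 2 + 2 * n)) ∧
      Summable (fun n : ℕ =>
        (-1) ^ n * (1 + q ^ (4 * n + 3)) *
          (qShift (q ^ 2 / a) (q ^ 2) (2 * n + 1) * qShift (q ^ 2 / b) (q ^ 2) (2 * n + 1) /
            (qShift (a * q ^ 2) (q ^ 2) (2 * n + 1) * qShift (b * q ^ 2) (q ^ 2) (2 * n + 1))) *
          (a * b) ^ (2 * n + 1) * q ^ (6 * n ^ 2 + 6 * n + 1)) ∧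
      qShiftInf (q ^ 2) (q ^ 2) * qShiftInf (a * b) (q ^ 2) /
          (qShiftInf (a * q ^ 2) (q ^ 2) * qShiftInf (b * q ^ 2) (q ^ 2)) *
        ∑' n : ℕ,
          qShift (q ^ 2 / a) (q ^ 2) n * qShift (q ^ 2 / b) (q ^ 2) n /
            (qShift (-q) (q ^ 2) n * qShift (q ^ 2) (q ^ 2) n * qShift q (q ^ 2) (n + 1)) *
            a ^ n * b ^ n =
      (∑' n : ℕ,
        (-1) ^ n * (1 + q ^ (4 * n + 1)) *
          (qShift (q ^ 2 / a) (q ^ 2) (2 * n) * qShift (q ^ 2 / b) (q ^ 2) (2 * n) /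
            (qShift (a * q ^ 2) (q ^ 2) (2 * n) * qShift (b * q ^ 2) (q ^ 2) (2 * n))) *
          (a * b) ^ (2 * n) * q ^ (6 * n ^ 2 + 2 * n)) -
      ∑' n : ℕ,
        (-1) ^ n * (1 + q ^ (4 * n + 3)) *
          (qShift (q ^ 2 / a) (q ^ 2) (2 * n + 1) * qShift (q ^ 2 / b) (q ^ 2) (2 * n + 1) /
            (qShift (a * q ^ 2) (q ^ 2) (2 * n + 1) * qShift (b * q ^ 2) (q ^ 2) (2 * n + 1))) *
          (a * b) ^ (2 * n + 1) * q ^ (6 * n ^ 2 + 6 * n + 1)) ∧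
    (Summable (fun n : ℕ =>
        qShiftScaled a (q ^ 2) n * qShiftScaled b (q ^ 2) n /
          (qShift (-q) (q ^ 2) n * qShift (q ^ 2) (q ^ 2) n * qShift q (q ^ 2) (n + 1))) ∧
      Summable (fun n : ℕ =>
        (-1) ^ n * (1 + q ^ (4 * n + 1)) *
          (qShiftScaled a (q ^ 2) (2 * n) * qShiftScaled b (q ^ 2) (2 * n) /
            (qShift (a * q ^ 2) (q ^ 2) (2 * n) * qShift (b * q ^ 2) (q ^ 2) (2 * n))) *
          q ^ (6 * n ^ 2 + 2 * n)) ∧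
      Summable (fun n : ℕ =>
        (-1) ^ n * (1 + q ^ (4 * n + 3)) *
          (qShiftScaled a (q ^ 2) (2 * n + 1) * qShiftScaled b (q ^ 2) (2 * n + 1) /
            (qShift (a * q ^ 2) (q ^ 2) (2 * n + 1) * qShift (b * q ^ 2) (q ^ 2) (2 * n + 1))) *
          q ^ (6 * n ^ 2 + 6 * n + 1)) ∧
      qShiftInf (q ^ 2) (q ^ 2) * qShiftInf (a * b) (q ^ 2) /
          (qShiftInf (a * q ^ 2) (q ^ 2) * qShiftInf (b * q ^ 2) (q ^ 2)) *
        ∑' n : ℕ,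
          qShiftScaled a (q ^ 2) n * qShiftScaled b (q ^ 2) n /
            (qShift (-q) (q ^ 2) n * qShift (q ^ 2) (q ^ 2) n * qShift q (q ^ 2) (n + 1)) =
      (∑' n : ℕ,
        (-1) ^ n * (1 + q ^ (4 * n + 1)) *
          (qShiftScaled a (q ^ 2) (2 * n) * qShiftScaled b (q ^ 2) (2 * n) /
            (qShift (a * q ^ 2) (q ^ 2) (2 * n) * qShift (b * q ^ 2) (q ^ 2) (2 * n))) *
          q ^ (6 * n ^ 2 + 2 * n)) -
      ∑' n : ℕ,
        (-1) ^ n * (1 + q ^ (4 * n + 3)) *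
          (qShiftScaled a (q ^ 2) (2 * n + 1) * qShiftScaled b (q ^ 2) (2 * n + 1) /
            (qShift (a * q ^ 2) (q ^ 2) (2 * n + 1) * qShift (b * q ^ 2) (q ^ 2) (2 * n + 1))) *
          q ^ (6 * n ^ 2 + 6 * n + 1)) := by
  refine (and_iff_right_of_imp fun h ha0 hb0 => ?_).2 ?_
  · simpa only [qShiftScaled_mul_qShiftScaled_div ha0 hb0, mul_pow, ← mul_assoc] using h
  · have hα := summable_slaterAlpha_mul_div hq ha hb hab
    simp only [← slaterAlpha_two_mul_mul, ← neg_slaterAlpha_two_mul_add_one_mul]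
    exact ⟨summable_qShiftScaled_mul_div hq hab,
      hα.comp_injective (mul_right_injective₀ (two_ne_zero' ℕ)),
      hα.neg.comp_injective ((add_left_injective 1).comp (mul_right_injective₀ (two_ne_zero' ℕ))),
      (tsum_qShiftScaled_mul_div hq ha hb hab).trans (tsum_even_sub_tsum_neg_odd hα).symm⟩

theorem theoremT9 (q a b : ℂ) (hq : ‖q‖ < 1) (ha : ‖a * q ^ 2‖ < 1) (hb : ‖b * q ^ 2‖ < 1)
    (hab : ‖a * b‖ < 1) :
    -- the identity for nonzero `a` and `b`, with all three series converging absolutely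
    (a ≠ 0 → b ≠ 0 →
      Summable (fun n : ℕ =>
        qShift (q ^ 2 / a) (q ^ 2) n * qShift (q ^ 2 / b) (q ^ 2) n /
          (qShift (-q) (q ^ 2) n * qShift (q ^ 2) (q ^ 2) n * qShift q (q ^ 2) (n + 1)) *
          a ^ n * b ^ n) ∧
      Summable (fun n : ℕ =>
        (-1) ^ n * (1 + q ^ (4 * n + 1)) *
          (qShift (q ^ 2 / a) (q ^ 2) (2 * n) * qShift (q ^ 2 / b) (q ^ 2) (2 * n) /
            (qShift (a * q ^ 2) (q ^ 2) (2 * n) * qShift (b * q ^ 2) (q ^ 2) (2 * n))) *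
          (a * b) ^ (2 * n) * q ^ (6 * n ^ 2 + 2 * n)) ∧
      Summable (fun n : ℕ =>
        (-1) ^ n * (1 + q ^ (4 * n + 3)) *
          (qShift (q ^ 2 / a) (q ^ 2) (2 * n + 1) * qShift (q ^ 2 / b) (q ^ 2) (2 * n + 1) /
            (qShift (a * q ^ 2) (q ^ 2) (2 * n + 1) * qShift (b * q ^ 2) (q ^ 2) (2 * n + 1))) *
          (a * b) ^ (2 * n + 1) * q ^ (6 * n ^ 2 + 6 * n + 1)) ∧
      qShiftInf (q ^ 2) (q ^ 2) * qShiftInf (a * b) (q ^ 2) /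
          (qShiftInf (a * q ^ 2) (q ^ 2) * qShiftInf (b * q ^ 2) (q ^ 2)) *
        ∑' n : ℕ,
          qShift (q ^ 2 / a) (q ^ 2) n * qShift (q ^ 2 / b) (q ^ 2) n /
            (qShift (-q) (q ^ 2) n * qShift (q ^ 2) (q ^ 2) n * qShift q (q ^ 2) (n + 1)) *
            a ^ n * b ^ n =
      (∑' n : ℕ,
        (-1) ^ n * (1 + q ^ (4 * n + 1)) *
          (qShift (q ^ 2 / a) (q ^ 2) (2 * n) * qShift (q ^ 2 / b) (q ^ 2) (2 * n) /
            (qShift (a * q ^ 2) (q ^ 2) (2 * n) * qShift (b * q ^ 2) (q ^ 2) (2 * n))) *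
          (a * b) ^ (2 * n) * q ^ (6 * n ^ 2 + 2 * n)) -
      ∑' n : ℕ,
        (-1) ^ n * (1 + q ^ (4 * n + 3)) *
          (qShift (q ^ 2 / a) (q ^ 2) (2 * n + 1) * qShift (q ^ 2 / b) (q ^ 2) (2 * n + 1) /
            (qShift (a * q ^ 2) (q ^ 2) (2 * n + 1) * qShift (b * q ^ 2) (q ^ 2) (2 * n + 1))) *
          (a * b) ^ (2 * n + 1) * q ^ (6 * n ^ 2 + 6 * n + 1)) ∧
    -- the same with `(q²/a; q²)_m a^m` and `(q²/b; q²)_m b^m` read as limits at `a = 0`, `b = 0`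
    (Summable (fun n : ℕ =>
        qShiftScaled a (q ^ 2) n * qShiftScaled b (q ^ 2) n /
          (qShift (-q) (q ^ 2) n * qShift (q ^ 2) (q ^ 2) n * qShift q (q ^ 2) (n + 1))) ∧
      Summable (fun n : ℕ =>
        (-1) ^ n * (1 + q ^ (4 * n + 1)) *
          (qShiftScaled a (q ^ 2) (2 * n) * qShiftScaled b (q ^ 2) (2 * n) /
            (qShift (a * q ^ 2) (q ^ 2) (2 * n) * qShift (b * q ^ 2) (q ^ 2) (2 * n))) *
          q ^ (6 * n ^ 2 + 2 * n)) ∧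
      Summable (fun n : ℕ =>
        (-1) ^ n * (1 + q ^ (4 * n + 3)) *
          (qShiftScaled a (q ^ 2) (2 * n + 1) * qShiftScaled b (q ^ 2) (2 * n + 1) /
            (qShift (a * q ^ 2) (q ^ 2) (2 * n + 1) * qShift (b * q ^ 2) (q ^ 2) (2 * n + 1))) *
          q ^ (6 * n ^ 2 + 6 * n + 1)) ∧
      qShiftInf (q ^ 2) (q ^ 2) * qShiftInf (a * b) (q ^ 2) /
          (qShiftInf (a * q ^ 2) (q ^ 2) * qShiftInf (b * q ^ 2) (q ^ 2)) *
        ∑' n : ℕ,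
          qShiftScaled a (q ^ 2) n * qShiftScaled b (q ^ 2) n /
            (qShift (-q) (q ^ 2) n * qShift (q ^ 2) (q ^ 2) n * qShift q (q ^ 2) (n + 1)) =
      (∑' n : ℕ,
        (-1) ^ n * (1 + q ^ (4 * n + 1)) *
          (qShiftScaled a (q ^ 2) (2 * n) * qShiftScaled b (q ^ 2) (2 * n) /
            (qShift (a * q ^ 2) (q ^ 2) (2 * n) * qShift (b * q ^ 2) (q ^ 2) (2 * n))) *
          q ^ (6 * n ^ 2 + 2 * n)) -
      ∑' n : ℕ,
        (-1) ^ n * (1 + q ^ (4 * n + 3)) *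
          (qShiftScaled a (q ^ 2) (2 * n + 1) * qShiftScaled b (q ^ 2) (2 * n + 1) /
            (qShift (a * q ^ 2) (q ^ 2) (2 * n + 1) * qShift (b * q ^ 2) (q ^ 2) (2 * n + 1))) *
          q ^ (6 * n ^ 2 + 6 * n + 1)) := by
  have hp : ‖q ^ 2‖ ≤ 1 := (norm_sq_lt_one hq).le
  exact theoremT9_general q a b hq (mul_pow_ne_one ha hp) (mul_pow_ne_one hb hp) hab
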